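/- Let $\mathbb{K}$ be a field. Let $\mathcal{S}$ be the $\mathbb{K}$-algebra of formal (possibly infinite) linear combinations of squarefree monomials $x_E=\prod_{(i,j)\in E}x_{ij}$, where $E$ is a finite set of pairs of positive integers $i<j$, with multiplication determined by $x_{ij}^2=x_{ij}$, that is, $\left(\sum_A f_A x_A\right)\left(\sum_B g_B x_B\right)=\sum_E\left(\sum_{A\cup B=E}f_A g_B\right)x_E$. For a finite simple graph $G$ without isolated vertex, on $n$ vertices and considered up to isomorphism, let $$\mathcal{M}_G=\sum_{r_1<\dots<r_n}\ \sum_{g}\ \prod_{i<j,\ \{i,j\}\in E(g)}x_{r_ir_j}\in\mathcal{S},$$ where $r_1<\dots<r_n$ runs over the increasing sequences of $n$ positive integers and $g$ over the distinct graphs on the vertex set $\{1,\dots,n\}$ that are isomorphic to $G$. The empty graph, with $0$ nodes and $0$ edges, is allowed and gives $\mathcal{M}_\emptyset=1$. Let $UGQSym$ be the $\mathbb{K}$-linear span of all the $\mathcal{M}_G$. Then $UGQSym$ is a subalgebra of $\mathcal{S}$, and with this product and the coproduct $$\Delta(\mathcal{M}_G)=\sum_{G'\sqcup G''=G}\mathcal{M}_{G'}\otimes\mathcal{M}_{G''},$$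 where the sum runs over the ordered pairs $(G',G'')$ of isomorphism classes of finite simple graphs without isolated vertex whose disjoint union is isomorphic to $G$, it is a well-defined Hopf algebra over $\mathbb{K}$. Moreover, it is a filtered Hopf algebra both by the number of edges and by the number of nodes. That is, if $F_n$ is the span of the $\mathcal{M}_G$ for which $G$ has at most $n$ edges (respectively, at most $n$ nodes), then $F_0\subseteq F_1\subseteq\cdots$, $\bigcup_n F_n=UGQSym$, $1\in F_0$, $F_i\cdot F_j\subseteq F_{i+j}$, $\Delta(F_n)\subseteq\sum_{i+j=n}F_i\otimes F_j$, and $S(F_n)\subseteq F_n$, where $S$ is the antipode. -/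

import Mathlib

open scoped TensorProduct

noncomputable section

namespace UGQ

/-- The index set of the variables `x_{ij}`: pairs of positive integers `i < j`. -/
abbrev Edge : Type := {p : ℕ+ × ℕ+ // p.1 < p.2}

/-- The algebra of formal series in the variables `x_{ij}`, `i < j`, subject to
`x_{ij} ^ 2 = x_{ij}`. A monomial is a finite set `S` of edges (the product of the `x_e`, `e ∈ S`);
a series is an arbitrary, possibly infinite, `K`-linear combination of monomials, given by its
coefficients. Two monomials multiply by union. -/
@[ext]
structure Series (K : Type*) where
  /-- The coefficient of a monomial. -/
  coeff : Finset Edge → K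

namespace Series

variable {K : Type*} [CommRing K]

instance : Zero (Series K) := ⟨⟨fun _ => 0⟩⟩
instance : Add (Series K) := ⟨fun f g => ⟨fun S => f.coeff S + g.coeff S⟩⟩
instance : Neg (Series K) := ⟨fun f => ⟨fun S => -f.coeff S⟩⟩
instance : SMul K (Series K) := ⟨fun c f => ⟨fun S => c * f.coeff S⟩⟩

/-- The series `1` is the empty monomial. -/
instance : One (Series K) := ⟨⟨fun S => if S = ∅ then 1 else 0⟩⟩

/-- `(f * g)_S = ∑_{A ∪ B = S} f_A g_B`, a finite sum. -/
instance : Mul (Series K) :=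
  ⟨fun f g => ⟨fun S => ∑ p ∈ (S.powerset ×ˢ S.powerset).filter (fun p => p.1 ∪ p.2 = S),
    f.coeff p.1 * g.coeff p.2⟩⟩

lemma coeff_mul (f g : Series K) (S : Finset Edge) : (f * g).coeff S =
    ∑ p ∈ (S.powerset ×ˢ S.powerset).filter (fun p => p.1 ∪ p.2 = S),
      f.coeff p.1 * g.coeff p.2 := rfl

@[simp] lemma coeff_zero (S : Finset Edge) : (0 : Series K).coeff S = 0 := rfl
@[simp] lemma coeff_add (f g : Series K) (S : Finset Edge) :
    (f + g).coeff S = f.coeff S + g.coeff S := rfl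
@[simp] lemma coeff_neg (f : Series K) (S : Finset Edge) : (-f).coeff S = -f.coeff S := rfl
@[simp] lemma coeff_smul (c : K) (f : Series K) (S : Finset Edge) :
    (c • f).coeff S = c * f.coeff S := rfl
lemma coeff_one (S : Finset Edge) : (1 : Series K).coeff S = if S = ∅ then 1 else 0 := rfl

instance : AddCommGroup (Series K) where
  add_assoc _ _ _ := by ext; simp [add_assoc]
  zero_add _ := by ext; simp
  add_zero _ := by ext; simp
  add_comm _ _ := by ext; simp [add_comm]
  neg_add_cancel _ := by ext; simp
  nsmul := nsmulRec
  zsmul := zsmulRec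

/-- The value of a series at the point whose coordinates are `1` on `T` and `0` elsewhere. -/
def value (f : Series K) (T : Finset Edge) : K := ∑ S ∈ T.powerset, f.coeff S

lemma value_injective {f g : Series K} (h : ∀ T, f.value T = g.value T) : f = g := by
  ext S
  induction S using Finset.strongInduction with
  | H S ih =>
    have := h S
    unfold value at this
    rw [← Finset.insert_erase (Finset.mem_powerset_self S),
      Finset.sum_insert (Finset.notMem_erase _ _), Finset.sum_insert (Finset.notMem_erase _ _),
      Finset.sum_congr rfl (fun A hA => ih A ?_)] at this
    · exact add_right_cancel this
    · rw [Finset.mem_erase, Finset.mem_powerset] at hA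
      exact lt_of_le_of_ne hA.2 hA.1

lemma value_mul (f g : Series K) (T : Finset Edge) :
    (f * g).value T = f.value T * g.value T := by
  unfold value
  rw [Finset.sum_mul_sum, ← Finset.sum_product',
    ← Finset.sum_fiberwise_of_maps_to (s := T.powerset ×ˢ T.powerset) (t := T.powerset)
      (g := fun p : Finset Edge × Finset Edge => p.1 ∪ p.2)]
  · refine Finset.sum_congr rfl fun S hS => ?_
    rw [coeff_mul]
    refine Finset.sum_congr ?_ fun _ _ => rfl
    ext p
    simp only [Finset.mem_filter, Finset.mem_product, Finset.mem_powerset] at *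
    refine ⟨fun h => ⟨⟨h.1.1.trans hS, h.1.2.trans hS⟩, h.2⟩, fun h => ⟨?_, h.2⟩⟩
    rw [← h.2]
    exact ⟨Finset.subset_union_left, Finset.subset_union_right⟩
  · intro p hp
    simp only [Finset.mem_product, Finset.mem_powerset] at *
    exact Finset.union_subset hp.1 hp.2

lemma value_add (f g : Series K) (T : Finset Edge) :
    (f + g).value T = f.value T + g.value T := by
  simp [value, Finset.sum_add_distrib]

lemma value_zero (T : Finset Edge) : (0 : Series K).value T = 0 := by
  simp [value]

lemma value_one (T : Finset Edge) : (1 : Series K).value T = 1 := by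
  simp [value, coeff_one]

instance : CommRing (Series K) where
  left_distrib _ _ _ := value_injective fun _ => by simp only [value_mul, value_add]; ring
  right_distrib _ _ _ := value_injective fun _ => by simp only [value_mul, value_add]; ring
  zero_mul _ := value_injective fun _ => by simp only [value_mul, value_zero]; ring
  mul_zero _ := value_injective fun _ => by simp only [value_mul, value_zero]; ring
  mul_assoc _ _ _ := value_injective fun _ => by simp only [value_mul]; ring
  one_mul _ := value_injective fun _ => by simp only [value_mul, value_one]; ring
  mul_one _ := value_injective fun _ => by simp only [value_mul, value_one]; ring
  mul_comm _ _ := value_injective fun _ => by simp only [value_mul]; ring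
  neg_add_cancel := neg_add_cancel
  zsmul := zsmulRec

instance : Module K (Series K) where
  one_smul _ := by ext; simp
  mul_smul _ _ _ := by ext; simp [mul_assoc]
  smul_zero _ := by ext; simp
  smul_add _ _ _ := by ext; simp [mul_add]
  add_smul _ _ _ := by ext; simp [add_mul]
  zero_smul _ := by ext; simp

instance : Algebra K (Series K) :=
  Algebra.ofModule
    (fun c f g => by ext S; simp [coeff_mul, Finset.mul_sum, mul_assoc])
    (fun c f g => by ext S; simp [coeff_mul, Finset.mul_sum, mul_left_comm])

end Series

/-- A finite simple graph with vertices `0, …, n - 1` and no isolated vertex. For `n = 0` this is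
the empty graph; there is none for `n = 1`. -/
structure LGraph where
  /-- The number of vertices. -/
  n : ℕ
  /-- The graph. -/
  graph : SimpleGraph (Fin n)
  /-- Every vertex has a neighbour. -/
  no_isolated : ∀ v, ∃ w, graph.Adj v w

/-- Graph isomorphism. -/
instance LGraph.isoSetoid : Setoid LGraph where
  r a b := Nonempty (a.graph ≃g b.graph)
  iseqv := ⟨fun _ => ⟨.refl⟩, fun ⟨e⟩ => ⟨e.symm⟩, fun ⟨e⟩ ⟨f⟩ => ⟨e.trans f⟩⟩

/-- Unlabeled graphs: isomorphism classes of finite simple graphs without isolated vertex. -/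
def UGraph : Type := Quotient LGraph.isoSetoid

lemma LGraph.n_eq {a b : LGraph} (h : Nonempty (a.graph ≃g b.graph)) : a.n = b.n := by
  obtain ⟨e⟩ := h
  simpa using Fintype.card_congr e.toEquiv

/-- The monomial `∏_{i < j, i ~ j} x_{r_i r_j}` for `r_1 < ⋯ < r_n`, as a set of edges. -/
def monomial {n : ℕ} (r : Fin n ↪o ℕ+) (g : SimpleGraph (Fin n)) : Finset Edge :=
  open Classical in
  (Finset.univ.filter fun p : {p : Fin n × Fin n // p.1 < p.2} => g.Adj p.1.1 p.1.2).image
    fun p => ⟨(r p.1.1, r p.1.2), r.lt_iff_lt.2 p.2⟩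

/-- The series `M_G = ∑_{r_1 < ⋯ < r_n} ∑_g ∏_{i < j, i ~ j in g} x_{r_i r_j}`, where `g` runs over
the orbit of `G` under relabeling, that is, over the graphs on the same vertices `0, …, n - 1`
isomorphic to `G`. The coefficient of a monomial is the number of times it occurs in the double
sum (finite, since `G` has no isolated vertex). -/
def LGraph.M (K : Type*) [CommRing K] (G : LGraph) : Series K :=
  ⟨fun S => (Nat.card {p : (Fin G.n ↪o ℕ+) × SimpleGraph (Fin G.n) //
    Nonempty (p.2 ≃g G.graph) ∧ monomial p.1 p.2 = S} : K)⟩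

lemma LGraph.M_congr (K : Type*) [CommRing K] (a b : LGraph) (h : a ≈ b) : a.M K = b.M K := by
  have hn := LGraph.n_eq h
  obtain ⟨n, g, hg⟩ := a
  obtain ⟨m, g', hg'⟩ := b
  obtain rfl : n = m := hn
  obtain ⟨e⟩ : Nonempty (g ≃g g') := h
  have key : ∀ k : SimpleGraph (Fin n), Nonempty (k ≃g g) ↔ Nonempty (k ≃g g') := fun k =>
    ⟨fun ⟨f⟩ => ⟨f.trans e⟩, fun ⟨f⟩ => ⟨f.trans e.symm⟩⟩
  simp only [LGraph.M, key]

namespace UGraph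

/-- The series `M_G` of an unlabeled graph. -/
def M (K : Type*) [CommRing K] : UGraph → Series K :=
  Quotient.lift (LGraph.M K) (LGraph.M_congr K)

/-- The number of nodes. -/
def nodes : UGraph → ℕ := Quotient.lift LGraph.n fun _ _ h => LGraph.n_eq h

/-- The number of edges. -/
def edges : UGraph → ℕ :=
  Quotient.lift (fun G => Nat.card G.graph.edgeSet) fun _ _ ⟨e⟩ => Nat.card_congr e.mapEdgeSet

/-- `G' ⊔ G'' = G`: the graph `G` is the disjoint union of `G'` and `G''`. -/
def IsDisjointUnion (G' G'' G : UGraph) : Prop :=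
  ∃ a b c : LGraph, (⟦a⟧ : UGraph) = G' ∧ (⟦b⟧ : UGraph) = G'' ∧ (⟦c⟧ : UGraph) = G ∧
    Nonempty ((a.graph ⊕g b.graph) ≃g c.graph)

lemma finite_nodes_le (N : ℕ) : {G : UGraph | G.nodes ≤ N}.Finite := by
  let T := Σ n : Fin (N + 1), {g : SimpleGraph (Fin n) // ∀ v, ∃ w, g.Adj v w}
  have : Finite T := inferInstance
  refine (Set.finite_range fun t : T => (⟦⟨t.1, t.2.1, t.2.2⟩⟧ : UGraph)).subset ?_
  intro G hG
  induction G using Quotient.inductionOn with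
  | h a => exact ⟨⟨⟨a.n, Nat.lt_succ_of_le hG⟩, ⟨a.graph, a.no_isolated⟩⟩, rfl⟩

lemma finite_splittings (G : UGraph) :
    {p : UGraph × UGraph | IsDisjointUnion p.1 p.2 G}.Finite := by
  refine ((finite_nodes_le G.nodes).prod (finite_nodes_le G.nodes)).subset ?_
  rintro ⟨_, _⟩ ⟨a, b, c, rfl, rfl, rfl, ⟨e⟩⟩
  have h : a.n + b.n = c.n := by simpa using Fintype.card_congr e.toEquiv
  exact ⟨show a.n ≤ c.n by omega, show b.n ≤ c.n by omega⟩

/-- The ordered pairs `(G', G'')` of unlabeled graphs with `G' ⊔ G'' = G`. -/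
def splittings (G : UGraph) : Finset (UGraph × UGraph) := (finite_splittings G).toFinset

end UGraph

/-- The space `UGQSym`: the linear span of the series `M_G`. -/
def UGQSym (K : Type*) [Field K] : Submodule K (Series K) :=
  Submodule.span K (Set.range (UGraph.M K))

/-- The series `M_G` as an element of a subalgebra whose underlying space is `UGQSym`. -/
def basisElt {K : Type*} [Field K] {A : Subalgebra K (Series K)}
    (hA : Subalgebra.toSubmodule A = UGQSym K) (G : UGraph) : A :=
  ⟨G.M K, by
    rw [← Subalgebra.mem_toSubmodule, hA]
    exact Submodule.subset_span ⟨G, rfl⟩⟩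

/-- An exhaustive increasing filtration of a Hopf algebra by subspaces `F 0 ⊆ F 1 ⊆ ⋯`,
compatible with unit, product, coproduct and antipode. -/
structure IsHopfFiltration (K : Type*) {H : Type*} [Field K] [Ring H] [HopfAlgebra K H]
    (F : ℕ → Submodule K H) : Prop where
  mono : Monotone F
  exhaustive : ∀ x, ∃ n, x ∈ F n
  one_mem : (1 : H) ∈ F 0
  mul_mem : ∀ i j x y, x ∈ F i → y ∈ F j → x * y ∈ F (i + j)
  comul_mem : ∀ n, ∀ x ∈ F n, Coalgebra.comul (R := K) x ∈
    ⨆ p ∈ Finset.HasAntidiagonal.antidiagonal n, LinearMap.range (TensorProduct.mapIncl (F p.1) (F p.2))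
  antipode_mem : ∀ n, ∀ x ∈ F n, HopfAlgebra.antipode K x ∈ F n

/-- The subspace `F n` spanned by those members of a family `m`, indexed by unlabeled graphs, for
which the statistic `d` of the graph is at most `n`. -/
def degreeFiltration (K : Type*) {H : Type*} [Field K] [AddCommMonoid H] [Module K H]
    (m : UGraph → H) (d : UGraph → ℕ) (n : ℕ) : Submodule K H :=
  Submodule.span K (m '' {G | d G ≤ n})

/-- The Hopf algebra `H` is filtered by the statistic `d`, with respect to a family `m` indexed by
unlabeled graphs. -/
def IsFilteredBy (K : Type*) {H : Type*} [Field K] [Ring H] [HopfAlgebra K H]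
    (m : UGraph → H) (d : UGraph → ℕ) : Prop :=
  IsHopfFiltration K (degreeFiltration K m d)

/-- The coproduct is given by `Δ(m_G) = ∑_{G' ⊔ G'' = G} m_{G'} ⊗ m_{G''}`, the sum over ordered
pairs of unlabeled graphs. -/
def HasSplittingCoproduct (K : Type*) {H : Type*} [Field K] [Ring H] [HopfAlgebra K H]
    (m : UGraph → H) : Prop :=
  ∀ G : UGraph, Coalgebra.comul (R := K) (m G) = ∑ p ∈ G.splittings, m p.1 ⊗ₜ[K] m p.2

end UGQ

end

/-! ### Hopf algebras with a basis indexed by a commutative monoid with finite antidiagonals -/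

noncomputable section

namespace AntidiagonalHopf

open Finset

variable {K U A : Type*} [Field K] [AddCommMonoid U]

section Sums

variable [HasAntidiagonal U] {M : Type*} [AddCommMonoid M]

/-! Call the shape of a finite set of edges the unlabeled graph it spans. A monomial determines its
increasing node sequence and its labeled graph, so the coefficient of `M_G` at `S` is 1 if `S` has
shape `G` and 0 otherwise (`coeff_M`). Hence the `M_G` are linearly independent.

Closure under products: the coefficients of `M_G * M_H` are unchanged by injective relabelings of
the nodes (`coeff_M_mul_M_map`), and sets of equal shape differ by such a relabeling
(`exists_map_of_shape_eq`). The product is therefore constant on shapes. Only finitely many shapes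
occur, because a union has at most as many nodes as its parts together (`M_mul_M_mem`).

Compatibility of product and coproduct: evaluating at a finite edge set `T` (variables 1 on `T`, 0
elsewhere) is a character, and these characters separate series. A subset of a disjoint union of `S`
and `T` is a subset of `S` together with a subset of `T`, so the value of `x` there is the value of
`Δ x` at `(S, T)` (`pairValue_comul`). Pairs of values separate the tensor square
(`eq_of_pairValue_eq`), so `Δ` is multiplicative. The counit is evaluation at `∅`.

The rest is formal. Unlabeled graphs form a commutative monoid under disjoint union, with finite
antidiagonals and an additive statistic vanishing only at 0; this gives coassociativity and a
recursive antipode. Nodes and edges are additive for disjoint union and subadditive for union of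
edge sets, which yields both filtrations. -/

lemma sum_antidiagonal_fst_eq_zero (g : U) (f : U × U → M)
    (hf : ∀ p, p.1 ≠ 0 → f p = 0) : ∑ p ∈ antidiagonal g, f p = f (0, g) := by
  refine sum_eq_single_of_mem _ (by simp) fun p hp hne => hf p fun h0 => hne ?_
  rw [HasAntidiagonal.mem_antidiagonal, h0, zero_add] at hp
  exact Prod.ext h0 hp

lemma sum_antidiagonal_snd_eq_zero (g : U) (f : U × U → M)
    (hf : ∀ p, p.2 ≠ 0 → f p = 0) : ∑ p ∈ antidiagonal g, f p = f (g, 0) := by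
  refine sum_eq_single_of_mem _ (by simp) fun p hp hne => hf p fun h0 => hne ?_
  rw [HasAntidiagonal.mem_antidiagonal, h0, add_zero] at hp
  exact Prod.ext hp h0

/-- Both sides run over the triples with sum `g`; this is the coassociativity of `comul`. -/
lemma sum_antidiagonal_assoc (g : U) (f : U → U → U → M) :
    ∑ p ∈ antidiagonal g, ∑ q ∈ antidiagonal p.1, f q.1 q.2 p.2 =
      ∑ p ∈ antidiagonal g, ∑ q ∈ antidiagonal p.2, f p.1 q.1 q.2 := by
  rw [sum_sigma', sum_sigma']
  refine sum_bij' (fun x _ => ⟨(x.2.1, x.2.2 + x.1.2), (x.2.2, x.1.2)⟩)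
    (fun x _ => ⟨(x.1.1 + x.2.1, x.2.2), (x.1.1, x.2.1)⟩) ?_ ?_ ?_ ?_ ?_
  · rintro ⟨⟨a, b⟩, c, d⟩ h
    simp only [mem_sigma, HasAntidiagonal.mem_antidiagonal] at h ⊢
    rw [← add_assoc, h.2, h.1]
    exact ⟨rfl, trivial⟩
  · rintro ⟨⟨a, b⟩, c, d⟩ h
    simp only [mem_sigma, HasAntidiagonal.mem_antidiagonal] at h ⊢
    rw [add_assoc, h.2, h.1]
    exact ⟨rfl, trivial⟩
  · rintro ⟨⟨a, b⟩, c, d⟩ h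
    simp only [mem_sigma, HasAntidiagonal.mem_antidiagonal] at h
    obtain ⟨-, rfl⟩ := h
    rfl
  · rintro ⟨⟨a, b⟩, c, d⟩ h
    simp only [mem_sigma, HasAntidiagonal.mem_antidiagonal] at h
    obtain ⟨-, rfl⟩ := h
    rfl
  · intros
    rfl

lemma antidiagonal_zero_eq (d : U →+ ℕ) (hd : ∀ g, d g = 0 → g = 0) :
    antidiagonal (0 : U) = {(0, 0)} := by
  ext p
  rw [HasAntidiagonal.mem_antidiagonal, mem_singleton]
  constructor
  · intro h
    have h3 := congrArg d h
    rw [map_add, map_zero] at h3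
    exact Prod.ext (hd _ (by omega)) (hd _ (by omega))
  · rintro rfl
    exact add_zero 0

end Sums

variable [CommRing A] [Algebra K A] (b : Module.Basis U K A)

/-- The coproduct `b g ↦ ∑_{g' + g'' = g} b g' ⊗ b g''`. -/
def comul [HasAntidiagonal U] : A →ₗ[K] A ⊗[K] A :=
  b.constr K fun g => ∑ p ∈ antidiagonal g, b p.1 ⊗ₜ[K] b p.2

/-- The counit `b g ↦ δ_{g, 0}`. -/
def counit [DecidableEq U] : A →ₗ[K] K := b.constr K fun g => if g = 0 then 1 else 0

lemma comul_basis [HasAntidiagonal U] (g : U) : comul b (b g) = ∑ p ∈ antidiagonal g, b p.1 ⊗ₜ[K] b p.2 :=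
  b.constr_basis K _ g

lemma counit_basis [DecidableEq U] (g : U) : counit b (b g) = if g = 0 then 1 else 0 :=
  b.constr_basis K _ g

variable [HasAntidiagonal U] [DecidableEq U]

/-- The coalgebra dual to the monoid algebra of `U`. -/
@[reducible]
def coalgebra : Coalgebra K A where
  comul := comul b
  counit := counit b
  coassoc := b.ext fun g => by
    simp only [LinearMap.comp_apply, comul_basis, map_sum, LinearMap.rTensor_tmul,
      LinearMap.lTensor_tmul, TensorProduct.sum_tmul, TensorProduct.tmul_sum,
      LinearEquiv.coe_coe, TensorProduct.assoc_tmul]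
    exact sum_antidiagonal_assoc g fun x y z => b x ⊗ₜ[K] (b y ⊗ₜ[K] b z)
  rTensor_counit_comp_comul := b.ext fun g => by
    simp only [LinearMap.comp_apply, comul_basis, map_sum, LinearMap.rTensor_tmul, counit_basis]
    rw [sum_antidiagonal_fst_eq_zero]
    · simp
    · intro p hp
      simp [hp]
  lTensor_counit_comp_comul := b.ext fun g => by
    simp only [LinearMap.comp_apply, comul_basis, map_sum, LinearMap.lTensor_tmul, counit_basis]
    rw [sum_antidiagonal_snd_eq_zero]
    · simp
    · intro p hp
      simp [hp]

/-- The values of the antipode on the basis, defined by recursion on a statistic `d`. -/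
def antipodeAux (d : U →+ ℕ) (hd : ∀ g, d g = 0 → g = 0) (g : U) : A :=
  if g = 0 then 1 else
    -∑ p ∈ (antidiagonal g).attach,
      if h : p.1.2 = 0 then 0 else antipodeAux d hd p.1.1 * b p.1.2
termination_by d g
decreasing_by
  -- A nonzero second component has positive degree, so the first has smaller degree than `g`.
  have h1 := congrArg d (HasAntidiagonal.mem_antidiagonal.1 p.2)
  rw [map_add] at h1
  have h2 : d p.1.2 ≠ 0 := fun h' => h (hd _ h')
  omega

/-- For `g ≠ 0`, the term at `(g, 0)` is `antipodeAux g` since `b 0 = 1`, and the recursion makes it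
the negative of all the others. -/
lemma sum_antipodeAux_mul (d : U →+ ℕ) (hd : ∀ g, d g = 0 → g = 0) (h1 : b 0 = 1) (g : U) :
    ∑ p ∈ antidiagonal g, antipodeAux b d hd p.1 * b p.2 = if g = 0 then 1 else 0 := by
  by_cases hg : g = 0
  · subst hg
    rw [antidiagonal_zero_eq d hd, sum_singleton, h1, antipodeAux]
    simp
  · have key : ∀ p ∈ antidiagonal g, antipodeAux b d hd p.1 * b p.2 =
        (if p.2 = 0 then antipodeAux b d hd g else 0) +
          (if p.2 = 0 then 0 else antipodeAux b d hd p.1 * b p.2) := by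
      intro p hp
      split_ifs with h
      · rw [HasAntidiagonal.mem_antidiagonal, h, add_zero] at hp
        rw [h, hp, h1, mul_one, add_zero]
      · rw [zero_add]
    rw [sum_congr rfl key, sum_add_distrib, sum_antidiagonal_snd_eq_zero, if_pos rfl,
      antipodeAux, if_neg hg, if_neg hg,
      sum_attach (antidiagonal g)
        (fun p => if _ : p.2 = 0 then 0 else antipodeAux b d hd p.1 * b p.2)]
    · simp only [dite_eq_ite, neg_add_cancel]
    · intro p hp
      simp [hp]

/-- A commutative algebra with a basis `b` indexed by `U` such that `b 0 = 1`, and such that the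
coproduct dual to the addition of `U` is multiplicative, is a Hopf algebra. -/
@[reducible]
def hopfAlgebra (d : U →+ ℕ) (hd : ∀ g, d g = 0 → g = 0) (h1 : b 0 = 1)
    (hcounit : ∀ x y, counit b (x * y) = counit b x * counit b y)
    (hcomul : ∀ x y, comul b (x * y) = comul b x * comul b y) : HopfAlgebra K A :=
  letI : Coalgebra K A := coalgebra b
  letI : Bialgebra K A := Bialgebra.mk' K A
    (show counit b 1 = 1 by rw [← h1, counit_basis, if_pos rfl])
    (fun {x y} => hcounit x y)
    (show comul b 1 = 1 by
      rw [← h1, comul_basis, antidiagonal_zero_eq d hd, sum_singleton, h1,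
        Algebra.TensorProduct.one_def])
    (fun {x y} => hcomul x y)
  have hr : LinearMap.mul' K A ∘ₗ (b.constr K (antipodeAux b d hd)).rTensor A ∘ₗ comul b =
      Algebra.linearMap K A ∘ₗ counit b := b.ext fun g => by
    simp only [LinearMap.comp_apply, comul_basis, map_sum, LinearMap.rTensor_tmul,
      LinearMap.mul'_apply, b.constr_basis, counit_basis, sum_antipodeAux_mul b d hd h1]
    split_ifs <;> simp
  { antipode := b.constr K (antipodeAux b d hd)
    mul_antipode_rTensor_comul := hr
    mul_antipode_lTensor_comul := by
      -- Since `A` and `U` are commutative, swapping the pairs turns the left antipode identity into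
      -- the right one.
      refine Eq.trans (b.ext fun g => ?_) hr
      change LinearMap.mul' K A (LinearMap.lTensor A _ (comul b (b g))) =
        LinearMap.mul' K A (LinearMap.rTensor A _ (comul b (b g)))
      simp only [comul_basis, map_sum, LinearMap.rTensor_tmul, LinearMap.lTensor_tmul,
        LinearMap.mul'_apply]
      refine sum_bij' (fun p _ => p.swap) (fun p _ => p.swap) ?_ ?_ ?_ ?_ ?_ <;>
        simp +contextual [mul_comm, add_comm] }

end AntidiagonalHopf

end

/-! ### Edge sets and unlabeled graphs -/

noncomputable section

namespace UGQ

open Finset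

/-- The graph on the positive integers with a given set of edges. -/
def edgeGraph (S : Finset Edge) : SimpleGraph ℕ+ where
  Adj i j := (∃ h : i < j, (⟨(i, j), h⟩ : Edge) ∈ S) ∨ ∃ h : j < i, (⟨(j, i), h⟩ : Edge) ∈ S
  symm := ⟨fun _ _ => Or.symm⟩
  loopless := ⟨fun _ h => h.elim (fun h => h.1.ne rfl) (fun h => h.1.ne rfl)⟩

lemma edgeGraph_adj_of_lt {S : Finset Edge} {i j : ℕ+} (h : i < j) :
    (edgeGraph S).Adj i j ↔ (⟨(i, j), h⟩ : Edge) ∈ S := by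
  simp [edgeGraph, h, h.not_gt]

lemma edgeGraph_eq_iff {S : Finset Edge} {g : SimpleGraph ℕ+} :
    edgeGraph S = g ↔ ∀ e : Edge, e ∈ S ↔ g.Adj e.1.1 e.1.2 := by
  constructor
  · rintro rfl ⟨⟨i, j⟩, h⟩
    exact (edgeGraph_adj_of_lt h).symm
  · intro H
    ext i j
    rcases lt_trichotomy i j with h | rfl | h
    · rw [edgeGraph_adj_of_lt h, H]
    · simp
    · rw [SimpleGraph.adj_comm, edgeGraph_adj_of_lt h, H, SimpleGraph.adj_comm]

lemma edgeGraph_injective : Function.Injective edgeGraph := fun S T h => by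
  ext e
  rw [edgeGraph_eq_iff.1 h e, ← edgeGraph_eq_iff.1 rfl e]

lemma edgeGraph_union (S T : Finset Edge) : edgeGraph (S ∪ T) = edgeGraph S ⊔ edgeGraph T := by
  rw [edgeGraph_eq_iff]
  intro e
  rw [mem_union, SimpleGraph.sup_adj, ← edgeGraph_eq_iff.1 rfl e, ← edgeGraph_eq_iff.1 rfl e]

lemma edgeGraph_monomial {n : ℕ} (r : Fin n ↪o ℕ+) (g : SimpleGraph (Fin n)) :
    edgeGraph (monomial r g) = g.map r := by
  classical
  rw [edgeGraph_eq_iff]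
  rintro ⟨⟨i, j⟩, h⟩
  change _ ↔ (g.map r.toEmbedding).Adj i j
  rw [SimpleGraph.map_adj]
  simp only [monomial, mem_image, mem_filter, mem_univ, true_and, Subtype.mk.injEq,
    Prod.mk.injEq]
  constructor
  · rintro ⟨⟨⟨u, v⟩, huv⟩, hadj, rfl, rfl⟩
    exact ⟨u, v, hadj, rfl, rfl⟩
  · rintro ⟨u, v, hadj, rfl, rfl⟩
    exact ⟨⟨(u, v), r.lt_iff_lt.1 h⟩, hadj, rfl, rfl⟩

/-- An injection of the positive integers acts on edges. -/
def edgeMap (f : ℕ+ ↪ ℕ+) : Edge ↪ Edge where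
  toFun e := ⟨(min (f e.1.1) (f e.1.2), max (f e.1.1) (f e.1.2)),
    min_lt_max.2 (f.injective.ne e.2.ne)⟩
  inj' := by
    rintro ⟨⟨a, b⟩, hab⟩ ⟨⟨c, d⟩, hcd⟩ h
    simp only [Subtype.mk.injEq, Prod.mk.injEq] at h hab hcd ⊢
    -- Equal minima and maxima leave two ways to match the endpoints; the crossed one contradicts `a
    -- < b` and `c < d`.
    have key : (f a = f c ∧ f b = f d) ∨ (f a = f d ∧ f b = f c) := by
      rcases le_total (f a) (f b) with h1 | h1 <;> rcases le_total (f c) (f d) with h2 | h2 <;>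
        simp [h1, h2] at h <;> tauto
    rcases key with ⟨h1, h2⟩ | ⟨h1, h2⟩
    · exact ⟨f.injective h1, f.injective h2⟩
    · rw [f.injective h1, f.injective h2] at hab
      exact (hab.asymm hcd).elim

lemma edgeMap_apply (f : ℕ+ ↪ ℕ+) (e : Edge) :
    (edgeMap f e).1 = (min (f e.1.1) (f e.1.2), max (f e.1.1) (f e.1.2)) := rfl

lemma edgeGraph_map (f : ℕ+ ↪ ℕ+) (S : Finset Edge) :
    edgeGraph (S.map (edgeMap f)) = (edgeGraph S).map f := by
  rw [edgeGraph_eq_iff]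
  rintro ⟨⟨i, j⟩, h⟩
  rw [SimpleGraph.map_adj]
  simp only [mem_map]
  constructor
  · rintro ⟨⟨⟨a, b⟩, hab⟩, hS, he⟩
    have h1 := congrArg (fun e : Edge => e.1.1) he
    have h2 := congrArg (fun e : Edge => e.1.2) he
    simp only [edgeMap_apply] at h1 h2
    have hadj := (edgeGraph_adj_of_lt hab).2 hS
    rcases le_total (f a) (f b) with h3 | h3
    · exact ⟨a, b, hadj, by simpa [h3] using h1, by simpa [h3] using h2⟩
    · exact ⟨b, a, hadj.symm, by simpa [h3] using h1, by simpa [h3] using h2⟩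
  · rintro ⟨a, b, hadj, rfl, rfl⟩
    simp only at h
    rcases lt_trichotomy a b with hab | rfl | hab
    · refine ⟨⟨(a, b), hab⟩, (edgeGraph_adj_of_lt hab).1 hadj, ?_⟩
      exact Subtype.ext (by simp [edgeMap_apply, h.le])
    · exact (h.ne rfl).elim
    · refine ⟨⟨(b, a), hab⟩, (edgeGraph_adj_of_lt hab).1 hadj.symm, ?_⟩
      exact Subtype.ext (by simp [edgeMap_apply, h.le])

/-- The set of nodes covered by a set of edges. -/
def nodeSet (S : Finset Edge) : Finset ℕ+ := S.image (fun e => e.1.1) ∪ S.image fun e => e.1.2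

lemma coe_nodeSet (S : Finset Edge) : (nodeSet S : Set ℕ+) = (edgeGraph S).support := by
  ext i
  simp only [nodeSet, coe_union, coe_image, Set.mem_union, Set.mem_image, mem_coe,
    SimpleGraph.mem_support]
  constructor
  · rintro (⟨e, he, rfl⟩ | ⟨e, he, rfl⟩)
    · exact ⟨_, (edgeGraph_eq_iff.1 rfl e).1 he⟩
    · exact ⟨_, ((edgeGraph_eq_iff.1 rfl e).1 he).symm⟩
  · rintro ⟨j, ⟨h, hS⟩ | ⟨h, hS⟩⟩
    · exact Or.inl ⟨_, hS, rfl⟩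
    · exact Or.inr ⟨_, hS, rfl⟩

lemma nodeSet_union (S T : Finset Edge) : nodeSet (S ∪ T) = nodeSet S ∪ nodeSet T := by
  rw [← coe_inj, coe_union, coe_nodeSet, coe_nodeSet, coe_nodeSet, edgeGraph_union]
  ext i
  simp [SimpleGraph.mem_support, exists_or]

/-- The unlabeled graph of a finite graph without isolated vertex. -/
def UGraph.of {V : Type*} [Fintype V] (g : SimpleGraph V) (hg : ∀ v, ∃ w, g.Adj v w) : UGraph :=
  ⟦⟨Fintype.card V, g.comap (Fintype.equivFin V).symm, fun v => by
    obtain ⟨w, hw⟩ := hg ((Fintype.equivFin V).symm v)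
    exact ⟨Fintype.equivFin V w, by simpa using hw⟩⟩⟧

lemma UGraph.of_eq_mk {V : Type*} [Fintype V] (g : SimpleGraph V) (hg : ∀ v, ∃ w, g.Adj v w)
    (a : LGraph) : UGraph.of g hg = ⟦a⟧ ↔ Nonempty (g ≃g a.graph) := by
  have e := SimpleGraph.Iso.comap (Fintype.equivFin V).symm g
  refine Quotient.eq.trans ⟨fun ⟨f⟩ => ⟨e.symm.trans f⟩, fun ⟨f⟩ => ⟨e.trans f⟩⟩

lemma UGraph.of_eq_of {V W : Type*} [Fintype V] [Fintype W] (g : SimpleGraph V)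
    (hg : ∀ v, ∃ w, g.Adj v w) (g' : SimpleGraph W) (hg' : ∀ v, ∃ w, g'.Adj v w) :
    UGraph.of g hg = UGraph.of g' hg' ↔ Nonempty (g ≃g g') := by
  have e := SimpleGraph.Iso.comap (Fintype.equivFin W).symm g'
  refine (UGraph.of_eq_mk g hg _).trans ⟨fun ⟨f⟩ => ⟨f.trans e⟩, fun ⟨f⟩ => ⟨f.trans e.symm⟩⟩

lemma exists_adj_induce_nodeSet (S : Finset Edge) (v : (nodeSet S : Set ℕ+)) :
    ∃ w, ((edgeGraph S).induce (nodeSet S)).Adj v w := by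
  obtain ⟨v, hv⟩ := v
  have hv' := hv
  rw [coe_nodeSet, SimpleGraph.mem_support] at hv'
  obtain ⟨w, hw⟩ := hv'
  refine ⟨⟨w, ?_⟩, hw⟩
  rw [coe_nodeSet]
  exact hw.mem_support_right

/-- The unlabeled graph spanned by a set of edges. -/
def shape (S : Finset Edge) : UGraph :=
  UGraph.of ((edgeGraph S).induce (nodeSet S)) (exists_adj_induce_nodeSet S)

lemma nodeSet_eq_range {S : Finset Edge} {V : Type*} {g : SimpleGraph V}
    (hg : ∀ v, ∃ w, g.Adj v w) {r : V ↪ ℕ+} (h : edgeGraph S = g.map r) :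
    (nodeSet S : Set ℕ+) = Set.range r := by
  rw [coe_nodeSet, h, SimpleGraph.support_map]
  have : g.support = Set.univ := Set.eq_univ_of_forall fun v => g.mem_support.2 (hg v)
  rw [this, Set.image_univ]

/-- As `g` has no isolated vertex, the range of any such `r` is exactly the node set of `S`, so `r`
is an isomorphism onto the induced graph. -/
lemma shape_eq_of_iff {V : Type*} [Fintype V] {g : SimpleGraph V} (hg : ∀ v, ∃ w, g.Adj v w)
    {S : Finset Edge} : shape S = UGraph.of g hg ↔ ∃ r : V ↪ ℕ+, edgeGraph S = g.map r := by
  rw [shape, UGraph.of_eq_of]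
  constructor
  · rintro ⟨e⟩
    refine ⟨e.symm.toEquiv.toEmbedding.trans (Function.Embedding.subtype _), ?_⟩
    ext i j
    rw [SimpleGraph.map_adj]
    constructor
    · intro h
      have hi : i ∈ (nodeSet S : Set ℕ+) := by rw [coe_nodeSet]; exact h.mem_support_left
      have hj : j ∈ (nodeSet S : Set ℕ+) := by rw [coe_nodeSet]; exact h.mem_support_right
      refine ⟨e ⟨i, hi⟩, e ⟨j, hj⟩, e.map_adj_iff.2 h, ?_, ?_⟩
      · exact congrArg Subtype.val (e.symm_apply_apply ⟨i, hi⟩)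
      · exact congrArg Subtype.val (e.symm_apply_apply ⟨j, hj⟩)
    · rintro ⟨u, v, h, rfl, rfl⟩
      exact e.symm.map_adj_iff.2 h
  · rintro ⟨r, h⟩
    have h2 := nodeSet_eq_range hg h
    rw [h2, h]
    exact ⟨(SimpleGraph.Embedding.map r g).isoInduceRange.symm⟩

lemma of_graph (a : LGraph) : UGraph.of a.graph a.no_isolated = ⟦a⟧ :=
  (UGraph.of_eq_mk _ _ _).2 ⟨.refl⟩

lemma shape_eq_mk_iff {a : LGraph} {S : Finset Edge} :
    shape S = ⟦a⟧ ↔ ∃ r : Fin a.n ↪ ℕ+, edgeGraph S = a.graph.map r := by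
  rw [← of_graph, shape_eq_of_iff]

lemma exists_edgeGraph_eq_map {n : ℕ} (g : SimpleGraph (Fin n)) (r : Fin n ↪ ℕ+) :
    ∃ S, edgeGraph S = g.map r := by
  classical
  refine ⟨(univ.filter fun p : (Fin n × Fin n) => g.Adj p.1 p.2 ∧ r p.1 < r p.2).attach.image
    fun p => ⟨(r p.1.1, r p.1.2), (mem_filter.1 p.2).2.2⟩, ?_⟩
  rw [edgeGraph_eq_iff]
  rintro ⟨⟨i, j⟩, h⟩
  rw [SimpleGraph.map_adj]
  simp only [mem_image, mem_attach, true_and, Subtype.mk.injEq, Prod.mk.injEq]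
  constructor
  · rintro ⟨⟨⟨u, v⟩, huv⟩, rfl, rfl⟩
    exact ⟨u, v, (mem_filter.1 huv).2.1, rfl, rfl⟩
  · rintro ⟨u, v, hadj, rfl, rfl⟩
    exact ⟨⟨(u, v), by simpa using ⟨hadj, h⟩⟩, rfl, rfl⟩

lemma shape_surjective : Function.Surjective shape := fun G => by
  induction G using Quotient.inductionOn with
  | h a =>
    obtain ⟨S, hS⟩ := exists_edgeGraph_eq_map a.graph
      ((Fin.valEmbedding).trans ⟨Nat.succPNat, Nat.succPNat_injective⟩)
    exact ⟨S, shape_eq_mk_iff.2 ⟨_, hS⟩⟩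

lemma shape_map (f : ℕ+ ↪ ℕ+) (S : Finset Edge) : shape (S.map (edgeMap f)) = shape S := by
  obtain ⟨a, ha⟩ := Quotient.exists_rep (shape S)
  obtain ⟨r, hr⟩ := shape_eq_mk_iff.1 ha.symm
  rw [← ha]
  refine shape_eq_mk_iff.2 ⟨r.trans f, ?_⟩
  rw [edgeGraph_map, hr, SimpleGraph.map_map]
  rfl

lemma exists_map_of_shape_eq {S T : Finset Edge} (h : shape S = shape T) :
    ∃ f : ℕ+ ↪ ℕ+, T = S.map (edgeMap f) := by
  obtain ⟨a, ha⟩ := Quotient.exists_rep (shape S)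
  obtain ⟨r, hr⟩ := shape_eq_mk_iff.1 ha.symm
  obtain ⟨s, hs⟩ := shape_eq_mk_iff.1 (ha.trans h).symm
  -- Permutations of the positive integers act transitively on embeddings of a finite set, so some
  -- `σ` carries `r` to `s`.
  have := Equiv.Perm.isMultiplyPretransitive ℕ+ a.n
  obtain ⟨σ, hσ⟩ := MulAction.exists_smul_eq (Equiv.Perm ℕ+) r s
  refine ⟨σ.toEmbedding, edgeGraph_injective ?_⟩
  rw [edgeGraph_map, hr, hs, SimpleGraph.map_map, ← hσ]
  rfl

-- A monomial occurs at most once: its node set forces the increasing sequence `r`, and then `g` is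
-- the pullback of its graph along `r`.
open Classical in
lemma coeff_M (K : Type*) [CommRing K] (G : UGraph) (S : Finset Edge) :
    (G.M K).coeff S = if shape S = G then 1 else 0 := by
  induction G using Quotient.inductionOn with
  | h a =>
  change ((Nat.card {p : (Fin a.n ↪o ℕ+) × SimpleGraph (Fin a.n) //
    Nonempty (p.2 ≃g a.graph) ∧ monomial p.1 p.2 = S} : ℕ) : K) = _
  have iso_no_isolated : ∀ {k : SimpleGraph (Fin a.n)}, k ≃g a.graph → ∀ v, ∃ w, k.Adj v w := by
    intro k e v
    obtain ⟨w, hw⟩ := a.no_isolated (e v)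
    exact ⟨e.symm w, e.map_adj_iff.1 (by simpa using hw)⟩
  split_ifs with h
  · obtain ⟨r₀, hr₀⟩ := shape_eq_mk_iff.1 h
    have hrange := nodeSet_eq_range a.no_isolated hr₀
    have hcard : (nodeSet S).card = a.n := by
      have : nodeSet S = univ.map r₀ := by
        rw [← coe_inj, hrange]; simp
      rw [this, card_map, card_fin]
    have hsup : ((edgeGraph S).comap ((nodeSet S).orderEmbOfFin hcard)).map
        ((nodeSet S).orderEmbOfFin hcard).toEmbedding = edgeGraph S := by
      ext i j
      rw [SimpleGraph.map_adj]
      constructor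
      · rintro ⟨u, v, h, rfl, rfl⟩
        exact h
      · intro h
        have hi : i ∈ (nodeSet S : Set ℕ+) := by rw [coe_nodeSet]; exact h.mem_support_left
        have hj : j ∈ (nodeSet S : Set ℕ+) := by rw [coe_nodeSet]; exact h.mem_support_right
        rw [← range_orderEmbOfFin _ hcard] at hi hj
        obtain ⟨u, rfl⟩ := hi
        obtain ⟨v, rfl⟩ := hj
        exact ⟨u, v, h, rfl, rfl⟩
    have hiso : Nonempty ((edgeGraph S).comap ((nodeSet S).orderEmbOfFin hcard) ≃g a.graph) := by
      have hno : ∀ v, ∃ w, ((edgeGraph S).comap ((nodeSet S).orderEmbOfFin hcard)).Adj v w := by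
        intro v
        have hv : (nodeSet S).orderEmbOfFin hcard v ∈ (nodeSet S : Set ℕ+) :=
          orderEmbOfFin_mem _ hcard v
        obtain ⟨⟨w, hw⟩, hvw⟩ := exists_adj_induce_nodeSet S ⟨_, hv⟩
        rw [← range_orderEmbOfFin _ hcard] at hw
        obtain ⟨u, rfl⟩ := hw
        exact ⟨u, hvw⟩
      rw [← UGraph.of_eq_mk _ hno, ← h, eq_comm, shape_eq_of_iff]
      exact ⟨_, hsup.symm⟩
    have hmono : monomial ((nodeSet S).orderEmbOfFin hcard)
        ((edgeGraph S).comap ((nodeSet S).orderEmbOfFin hcard)) = S :=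
      edgeGraph_injective ((edgeGraph_monomial _ _).trans hsup)
    rw [Nat.card_eq_one_iff_unique.2 ⟨⟨?_⟩, ⟨⟨(_, _), hiso, hmono⟩⟩⟩, Nat.cast_one]
    · rintro ⟨⟨r, g⟩, ⟨e⟩, hS⟩ ⟨⟨r', g'⟩, ⟨e'⟩, hS'⟩
      have hg := edgeGraph_monomial r g
      have hg' := edgeGraph_monomial r' g'
      simp only at hS hS'
      rw [hS] at hg
      rw [hS'] at hg'
      have h1 := nodeSet_eq_range (r := r.toEmbedding) (iso_no_isolated e) hg
      have h2 := nodeSet_eq_range (r := r'.toEmbedding) (iso_no_isolated e') hg'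
      obtain rfl : r = r' := OrderEmbedding.range_inj.1 (h1.symm.trans h2)
      obtain rfl : g = g' := SimpleGraph.map_injective r.toEmbedding (hg.symm.trans hg')
      rfl
  · rw [Nat.card_eq_zero.2 (Or.inl ⟨?_⟩), Nat.cast_zero]
    rintro ⟨⟨r, g⟩, ⟨e⟩, hS⟩
    have hg := edgeGraph_monomial r g
    simp only at hS
    rw [hS] at hg
    refine h ?_
    rw [(shape_eq_of_iff (iso_no_isolated e)).2 ⟨r.toEmbedding, hg⟩, UGraph.of_eq_mk]
    exact ⟨e⟩

end UGQ

end

/-! ### The monoid of unlabeled graphs under disjoint union -/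

noncomputable section

namespace UGQ

open Finset

lemma exists_adj_sum {V W : Type*} {g : SimpleGraph V} {h : SimpleGraph W}
    (hg : ∀ v, ∃ w, g.Adj v w) (hh : ∀ v, ∃ w, h.Adj v w) (v : V ⊕ W) :
    ∃ w, (g ⊕g h).Adj v w := by
  rcases v with v | v
  · exact (hg v).imp' Sum.inl fun _ => SimpleGraph.sum_adj_inl.2
  · exact (hh v).imp' Sum.inr fun _ => SimpleGraph.sum_adj_inr.2

namespace UGraph

/-- Disjoint union. -/
instance : Add UGraph :=
  ⟨Quotient.lift₂ (fun a b : LGraph => UGraph.of (a.graph ⊕g b.graph)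
      (exists_adj_sum a.no_isolated b.no_isolated)) fun _ _ _ _ ⟨e⟩ ⟨f⟩ =>
    (UGraph.of_eq_of _ _ _ _).2 ⟨e.sumCongr f⟩⟩

/-- The empty graph. -/
instance : Zero UGraph := ⟨UGraph.of (⊥ : SimpleGraph Empty) nofun⟩

lemma exists_eq_of (G : UGraph) : ∃ a : LGraph, UGraph.of a.graph a.no_isolated = G :=
  (Quotient.exists_rep G).imp fun a h => (of_graph a).trans h

lemma of_add_of {V W : Type*} [Fintype V] [Fintype W] {g : SimpleGraph V} {h : SimpleGraph W}
    (hg : ∀ v, ∃ w, g.Adj v w) (hh : ∀ v, ∃ w, h.Adj v w) :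
    UGraph.of g hg + UGraph.of h hh = UGraph.of (g ⊕g h) (exists_adj_sum hg hh) :=
  (UGraph.of_eq_of _ (exists_adj_sum (LGraph.no_isolated _) (LGraph.no_isolated _)) _ _).2
    ⟨SimpleGraph.Iso.sumCongr (SimpleGraph.Iso.comap _ _) (SimpleGraph.Iso.comap _ _)⟩

lemma zero_def : (0 : UGraph) = UGraph.of (⊥ : SimpleGraph Empty) nofun := rfl

lemma add_comm' (G H : UGraph) : G + H = H + G := by
  obtain ⟨a, rfl⟩ := exists_eq_of G
  obtain ⟨b, rfl⟩ := exists_eq_of H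
  rw [of_add_of, of_add_of, UGraph.of_eq_of]
  exact ⟨SimpleGraph.Iso.sumComm⟩

lemma zero_add' (G : UGraph) : 0 + G = G := by
  obtain ⟨a, rfl⟩ := exists_eq_of G
  rw [zero_def, of_add_of, UGraph.of_eq_of]
  exact ⟨⟨Equiv.emptySum Empty _, by rintro (⟨⟨⟩⟩ | u) (⟨⟨⟩⟩ | v); simp⟩⟩

instance : AddCommMonoid UGraph where
  add_assoc G H J := by
    obtain ⟨a, rfl⟩ := exists_eq_of G
    obtain ⟨b, rfl⟩ := exists_eq_of H
    obtain ⟨c, rfl⟩ := exists_eq_of J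
    rw [of_add_of, of_add_of, of_add_of, of_add_of, UGraph.of_eq_of]
    exact ⟨SimpleGraph.Iso.sumAssoc⟩
  zero_add := zero_add'
  add_zero G := (add_comm' G 0).trans (zero_add' G)
  add_comm := add_comm'
  nsmul := nsmulRec

lemma isDisjointUnion_iff (G' G'' G : UGraph) : IsDisjointUnion G' G'' G ↔ G' + G'' = G := by
  constructor
  · rintro ⟨a, b, c, rfl, rfl, rfl, h⟩
    rw [← of_graph, ← of_graph b, of_add_of, UGraph.of_eq_mk]
    exact h
  · rintro rfl
    obtain ⟨a, rfl⟩ := exists_eq_of G'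
    obtain ⟨b, rfl⟩ := exists_eq_of G''
    rw [of_add_of]
    obtain ⟨c, hc⟩ := Quotient.exists_rep (UGraph.of (a.graph ⊕g b.graph)
      (exists_adj_sum a.no_isolated b.no_isolated))
    exact ⟨a, b, c, (of_graph a).symm, (of_graph b).symm, hc,
      (UGraph.of_eq_mk _ _ _).1 hc.symm⟩

instance : HasAntidiagonal UGraph where
  antidiagonal := splittings
  mem_antidiagonal := by
    rintro G p
    rw [splittings, Set.Finite.mem_toFinset, Set.mem_ofPred_eq, isDisjointUnion_iff]

lemma nodes_of {V : Type*} [Fintype V] {g : SimpleGraph V} (hg : ∀ v, ∃ w, g.Adj v w) :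
    (UGraph.of g hg).nodes = Fintype.card V := rfl

lemma edges_of {V : Type*} [Fintype V] {g : SimpleGraph V} (hg : ∀ v, ∃ w, g.Adj v w) :
    (UGraph.of g hg).edges = Nat.card g.edgeSet :=
  Nat.card_congr (SimpleGraph.Iso.comap _ _).mapEdgeSet

/-- The number of nodes, as an additive map. -/
def nodesHom : UGraph →+ ℕ where
  toFun := nodes
  map_zero' := by simp [zero_def, nodes_of]
  map_add' G H := by
    obtain ⟨a, rfl⟩ := exists_eq_of G
    obtain ⟨b, rfl⟩ := exists_eq_of H
    simp [of_add_of, nodes_of]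

/-- The number of edges, as an additive map. -/
def edgesHom : UGraph →+ ℕ where
  toFun := edges
  map_zero' := by simp [zero_def, edges_of]
  map_add' G H := by
    obtain ⟨a, rfl⟩ := exists_eq_of G
    obtain ⟨b, rfl⟩ := exists_eq_of H
    rw [of_add_of, edges_of, edges_of, edges_of, Nat.card_congr SimpleGraph.edgeSetSumEquiv,
      Nat.card_sum]

lemma eq_zero_of_nodes_eq_zero {G : UGraph} (h : G.nodes = 0) : G = 0 := by
  induction G using Quotient.inductionOn with
  | h a =>
    have : IsEmpty (Fin a.n) := by
      rw [show a.n = 0 from h]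
      infer_instance
    rw [← of_graph, zero_def, UGraph.of_eq_of]
    exact ⟨⟨Equiv.equivOfIsEmpty _ _, fun {x} => isEmptyElim x⟩⟩

end UGraph

/-! ### Statistics and disjoint unions of edge sets -/

lemma nodes_shape (S : Finset Edge) : (shape S).nodes = (nodeSet S).card := by
  rw [shape, UGraph.nodes_of]
  simp

lemma edgeSet_edgeGraph (S : Finset Edge) :
    (edgeGraph S).edgeSet = (fun e : Edge => s(e.1.1, e.1.2)) '' S := by
  ext z
  induction z using Sym2.inductionOn with
  | hf i j =>
  rw [SimpleGraph.mem_edgeSet]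
  simp only [Set.mem_image, mem_coe]
  constructor
  · rintro (⟨h, hS⟩ | ⟨h, hS⟩)
    · exact ⟨_, hS, rfl⟩
    · exact ⟨_, hS, Sym2.eq_swap⟩
  · rintro ⟨e, he, h⟩
    rw [← SimpleGraph.mem_edgeSet, ← h, SimpleGraph.mem_edgeSet]
    exact (edgeGraph_eq_iff.1 rfl e).1 he

lemma edges_shape (S : Finset Edge) : (shape S).edges = S.card := by
  obtain ⟨a, ha⟩ := Quotient.exists_rep (shape S)
  obtain ⟨r, hr⟩ := shape_eq_mk_iff.1 ha.symm
  rw [← ha, ← of_graph, UGraph.edges_of]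
  have h1 := congrArg (fun g => Nat.card g.edgeSet) hr
  simp only [SimpleGraph.edgeSet_map, edgeSet_edgeGraph] at h1
  rw [Nat.card_image_of_injective r.sym2Map.injective, Nat.card_image_of_injective] at h1
  · simpa using h1.symm
  · rintro ⟨⟨i, j⟩, h⟩ ⟨⟨k, l⟩, h'⟩ he
    rcases Sym2.eq_iff.1 he with ⟨h1, h2⟩ | ⟨h1, h2⟩
    · exact Subtype.ext (Prod.ext h1 h2)
    · simp only at h1 h2 h h'
      subst h1 h2
      exact (h.asymm h').elim

lemma nodes_shape_union_le (S T : Finset Edge) :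
    (shape (S ∪ T)).nodes ≤ (shape S).nodes + (shape T).nodes := by
  rw [nodes_shape, nodes_shape, nodes_shape, nodeSet_union]
  exact card_union_le _ _

lemma edges_shape_union_le (S T : Finset Edge) :
    (shape (S ∪ T)).edges ≤ (shape S).edges + (shape T).edges := by
  rw [edges_shape, edges_shape, edges_shape]
  exact card_union_le _ _

lemma shape_eq_zero_iff {S : Finset Edge} : shape S = 0 ↔ S = ∅ := by
  constructor
  · intro h
    have := edges_shape S
    rw [h, show UGraph.edges 0 = 0 from UGraph.edgesHom.map_zero] at this
    exact card_eq_zero.1 this.symm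
  · rintro rfl
    exact UGraph.eq_zero_of_nodes_eq_zero (by rw [nodes_shape]; rfl)

/-- A pairing function for the positive integers. -/
def pairing : ℕ+ ⊕ ℕ+ ≃ ℕ+ := Classical.choice (nonempty_equiv_of_countable)

/-- Two disjoint copies of the edges inside the edges. -/
def edgePairing : Edge ⊕ Edge ↪ Edge where
  toFun := Sum.elim (edgeMap (Function.Embedding.inl.trans pairing.toEmbedding))
    (edgeMap (Function.Embedding.inr.trans pairing.toEmbedding))
  inj' := by
    refine (edgeMap _).injective.sumElim (edgeMap _).injective fun e e' h => ?_
    -- The smaller endpoints of the two image edges lie in the disjoint images of the two summands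
    -- under `pairing`.
    have h1 := congrArg (fun e : Edge => e.1.1) h
    simp only [edgeMap_apply] at h1
    rcases min_choice (Function.Embedding.inl.trans pairing.toEmbedding e.1.1)
        (Function.Embedding.inl.trans pairing.toEmbedding e.1.2) with h2 | h2 <;>
      rcases min_choice (Function.Embedding.inr.trans pairing.toEmbedding e'.1.1)
        (Function.Embedding.inr.trans pairing.toEmbedding e'.1.2) with h3 | h3 <;>
      rw [h2, h3] at h1 <;> simp at h1

/-- The disjoint union of two sets of edges. -/
def disjUnionEdges (S T : Finset Edge) : Finset Edge := (S.disjSum T).map edgePairing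

lemma disjUnionEdges_eq (S T : Finset Edge) : disjUnionEdges S T =
    S.map (edgeMap (Function.Embedding.inl.trans pairing.toEmbedding)) ∪
      T.map (edgeMap (Function.Embedding.inr.trans pairing.toEmbedding)) := by
  ext e
  simp [disjUnionEdges, edgePairing]

lemma map_sum_eq_sup {V W X : Type*} (g : SimpleGraph V) (h : SimpleGraph W) (f : V ⊕ W ↪ X) :
    (g ⊕g h).map f = g.map (Function.Embedding.inl.trans f) ⊔
      h.map (Function.Embedding.inr.trans f) := by
  ext i j
  rw [SimpleGraph.sup_adj, SimpleGraph.map_adj, SimpleGraph.map_adj, SimpleGraph.map_adj]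
  simp [Sum.exists]

lemma shape_disjUnionEdges (S T : Finset Edge) :
    shape (disjUnionEdges S T) = shape S + shape T := by
  obtain ⟨a, ha⟩ := UGraph.exists_eq_of (shape S)
  obtain ⟨b, hb⟩ := UGraph.exists_eq_of (shape T)
  obtain ⟨r, hr⟩ := (shape_eq_of_iff _).1 ha.symm
  obtain ⟨s, hs⟩ := (shape_eq_of_iff _).1 hb.symm
  rw [← ha, ← hb, UGraph.of_add_of, shape_eq_of_iff]
  refine ⟨(r.sumMap s).trans pairing.toEmbedding, ?_⟩
  rw [disjUnionEdges_eq, edgeGraph_union, edgeGraph_map, edgeGraph_map, hr, hs, map_sum_eq_sup,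
    SimpleGraph.map_map, SimpleGraph.map_map]
  rfl

/-- Each subset of the disjoint union splits uniquely into its left and right parts. -/
lemma sum_powerset_disjUnionEdges {M : Type*} [AddCommMonoid M] (S T : Finset Edge)
    (f : Finset Edge → M) : ∑ C ∈ (disjUnionEdges S T).powerset, f C =
      ∑ A ∈ S.powerset, ∑ B ∈ T.powerset, f (disjUnionEdges A B) := by
  rw [← sum_product']
  symm
  refine sum_bij (fun p _ => disjUnionEdges p.1 p.2) ?_ ?_ ?_ fun _ _ => rfl
  · rintro ⟨A, B⟩ h
    simp only [mem_product, mem_powerset] at h ⊢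
    exact map_subset_map.2 (disjSum_mono h.1 h.2)
  · rintro ⟨A, B⟩ - ⟨A', B'⟩ - h
    have h' := map_injective _ h
    have h1 := congrArg toLeft h'
    have h2 := congrArg toRight h'
    simp only [toLeft_disjSum, toRight_disjSum] at h1 h2
    exact Prod.ext h1 h2
  · intro C hC
    rw [mem_powerset, disjUnionEdges, subset_map_iff] at hC
    obtain ⟨u, hu, rfl⟩ := hC
    refine ⟨(u.toLeft, u.toRight), ?_, ?_⟩
    · rw [mem_product, mem_powerset, mem_powerset]
      have h1 := toLeft_subset_toLeft hu
      have h2 := toRight_subset_toRight hu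
      rw [toLeft_disjSum] at h1
      rw [toRight_disjSum] at h2
      exact ⟨h1, h2⟩
    · simp only [disjUnionEdges, toLeft_disjSum_toRight]

end UGQ

end

/-! ### The Hopf algebra of unlabeled graphs -/

noncomputable section

namespace UGQ

open Finset

variable {K : Type*} [Field K]

-- Relabeling preserves unions and shapes, and every subset of the image of `S` is the image of a
-- subset of `S`; so the pairs with union `S` correspond to those with union its image.
open Classical in
lemma coeff_M_mul_M_map (G H : UGraph) (f : ℕ+ ↪ ℕ+) (S : Finset Edge) :
    (G.M K * H.M K).coeff (S.map (edgeMap f)) = (G.M K * H.M K).coeff S := by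
  rw [Series.coeff_mul, Series.coeff_mul]
  symm
  refine sum_bij (fun p _ => (p.1.map (edgeMap f), p.2.map (edgeMap f))) ?_ ?_ ?_ ?_
  · rintro ⟨A, B⟩ h
    simp only [mem_filter, mem_product, mem_powerset] at h ⊢
    exact ⟨⟨map_subset_map.2 h.1.1, map_subset_map.2 h.1.2⟩, by rw [← map_union, h.2]⟩
  · rintro ⟨A, B⟩ - ⟨A', B'⟩ - h
    exact Prod.ext (map_injective _ (congrArg Prod.fst h)) (map_injective _ (congrArg Prod.snd h))
  · rintro ⟨A, B⟩ h
    simp only [mem_filter, mem_product, mem_powerset, subset_map_iff] at h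
    obtain ⟨⟨⟨A', hA, rfl⟩, ⟨B', hB, rfl⟩⟩, h⟩ := h
    refine ⟨(A', B'), ?_, rfl⟩
    simp only [mem_filter, mem_product, mem_powerset]
    exact ⟨⟨hA, hB⟩, map_injective (edgeMap f) (by rw [map_union, h])⟩
  · rintro ⟨A, B⟩ -
    simp only [coeff_M, shape_map]

open Classical in
lemma le_of_coeff_M_mul_M_ne_zero {d : UGraph → ℕ}
    (hd : ∀ A B, d (shape (A ∪ B)) ≤ d (shape A) + d (shape B)) {G H : UGraph} {S : Finset Edge}
    (h : (G.M K * H.M K).coeff S ≠ 0) : d (shape S) ≤ d G + d H := by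
  rw [Series.coeff_mul] at h
  obtain ⟨⟨A, B⟩, hp, hne⟩ := exists_ne_zero_of_sum_ne_zero h
  obtain ⟨-, rfl⟩ := mem_filter.1 hp
  simp only [coeff_M, ne_eq, mul_eq_zero, ite_eq_right_iff, one_ne_zero, imp_false, not_or,
    not_not] at hne
  rw [← hne.1, ← hne.2]
  exact hd A B

/-- A set of edges that spans a given unlabeled graph. -/
def realization (G : UGraph) : Finset Edge := Function.surjInv shape_surjective G

lemma shape_realization (G : UGraph) : shape (realization G) = G :=
  Function.surjInv_eq shape_surjective G

/-- A coefficient, as a linear form. -/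
def coeffLinear (S : Finset Edge) : Series K →ₗ[K] K where
  toFun f := f.coeff S
  map_add' _ _ := rfl
  map_smul' _ _ := rfl

/-- The value at a set of edges, as a character. -/
def valueHom (T : Finset Edge) : Series K →ₐ[K] K :=
  AlgHom.ofLinearMap (∑ S ∈ T.powerset, coeffLinear S)
    (by rw [LinearMap.sum_apply]; exact Series.value_one T)
    (fun f g => by simp only [LinearMap.sum_apply]; exact Series.value_mul f g T)

lemma valueHom_apply (T : Finset Edge) (f : Series K) : valueHom T f = f.value T :=
  LinearMap.sum_apply _ _ _

/-- The product of two of the series `M_G` is a linear combination of such series. -/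
lemma M_mul_M_mem {d : UGraph → ℕ}
    (hd : ∀ A B, d (shape (A ∪ B)) ≤ d (shape A) + d (shape B)) (G H : UGraph) :
    G.M K * H.M K ∈ Submodule.span K (UGraph.M K '' {E | d E ≤ d G + d H}) := by
  classical
  -- Each coefficient is read off at one realization of its shape. The sum is indexed by the node
  -- bound whatever `d` is, to keep it finite; `d` only enters afterwards, to bound the terms that
  -- are nonzero.
  have key : G.M K * H.M K =
      ∑ E ∈ (UGraph.finite_nodes_le (G.nodes + H.nodes)).toFinset,
        (G.M K * H.M K).coeff (realization E) • E.M K := by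
    ext S
    have h1 : (G.M K * H.M K).coeff (realization (shape S)) =
        (G.M K * H.M K).coeff S := by
      obtain ⟨f, hf⟩ := exists_map_of_shape_eq
        (shape_realization (shape S)).symm
      rw [hf, coeff_M_mul_M_map]
    change _ = coeffLinear S _
    rw [map_sum, sum_congr rfl (g := fun E => if shape S = E then
      (G.M K * H.M K).coeff S else 0)]
    · rw [sum_ite_eq]
      split_ifs with h
      · rfl
      · by_contra h0
        exact h ((Set.Finite.mem_toFinset _).2 (le_of_coeff_M_mul_M_ne_zero nodes_shape_union_le h0))
    · intro E _
      rw [map_smul, smul_eq_mul]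
      change _ * (E.M K).coeff S = _
      rw [coeff_M]
      split_ifs with h
      · rw [← h, h1, mul_one]
      · rw [mul_zero]
  rw [key]
  refine Submodule.sum_mem _ fun E _ => ?_
  by_cases h0 : (G.M K * H.M K).coeff (realization E) = 0
  · rw [h0, zero_smul]
    exact Submodule.zero_mem _
  · refine Submodule.smul_mem _ _ (Submodule.subset_span ⟨E, ?_, rfl⟩)
    have := le_of_coeff_M_mul_M_ne_zero hd h0
    rwa [shape_realization] at this

lemma M_zero : (0 : UGraph).M K = 1 := by
  ext S
  simp only [coeff_M, shape_eq_zero_iff, Series.coeff_one]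

/-- The space `UGQSym` as a subalgebra. -/
def algebra (K : Type*) [Field K] : Subalgebra K (Series K) :=
  (UGQSym K).toSubalgebra (Submodule.subset_span ⟨0, M_zero⟩) fun x y hx hy => by
    have h := Submodule.mul_mem_mul hx hy
    rw [UGQSym, Submodule.span_mul_span] at h
    refine Submodule.span_le.2 ?_ h
    rintro _ ⟨_, ⟨G, rfl⟩, _, ⟨H, rfl⟩, rfl⟩
    exact Submodule.span_mono (Set.image_subset_range _ _) (M_mul_M_mem nodes_shape_union_le G H)

lemma toSubmodule_algebra : Subalgebra.toSubmodule (algebra K) = UGQSym K :=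
  Submodule.toSubalgebra_toSubmodule _ _ _

/-- The series `M_G` in the algebra. -/
abbrev elt (G : UGraph) : algebra K := basisElt toSubmodule_algebra G

lemma coe_elt (G : UGraph) : ((elt G : algebra K) : Series K) = G.M K := rfl

lemma map_val_span_image (s : Set UGraph) :
    (Submodule.span K (elt (K := K) '' s)).map (algebra K).val.toLinearMap =
      Submodule.span K (UGraph.M K '' s) := by
  rw [Submodule.map_span, Set.image_image]
  rfl

lemma mem_span_elt_iff {s : Set UGraph} {x : algebra K} :
    x ∈ Submodule.span K (elt '' s) ↔ (x : Series K) ∈ Submodule.span K (UGraph.M K '' s) := by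
  rw [← map_val_span_image]
  refine ⟨fun h => ⟨x, h, rfl⟩, ?_⟩
  rintro ⟨y, hy, h⟩
  rwa [← Subtype.ext h]

lemma elt_zero : elt (K := K) 0 = 1 := Subtype.ext M_zero

open Classical in
lemma coeffLinear_elt (S : Finset Edge) (G : UGraph) :
    coeffLinear S (elt (K := K) G : Series K) = if shape S = G then 1 else 0 :=
  coeff_M K G S

/-- The series `M_G` form a basis. -/
def eltBasis (K : Type*) [Field K] : Module.Basis UGraph K (algebra K) :=
  Module.Basis.mk (v := elt)
    (LinearIndependent.of_pairwise_dual_eq_zero_one _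
      -- The coefficient at a realization of `G` is 1 on `M_G` and 0 on the other series, so these
      -- forms are a dual family.
      (fun G => coeffLinear (realization G) ∘ₗ
        (algebra K).val.toLinearMap)
      (fun G H h => by
        classical
        refine (coeffLinear_elt _ _).trans (if_neg ?_)
        rwa [shape_realization])
      (fun G => by
        classical
        exact (coeffLinear_elt _ _).trans (if_pos (shape_realization _))))
    (fun x _ => by
      rw [← Set.image_univ, mem_span_elt_iff, Set.image_univ]
      exact x.2)

lemma eltBasis_apply (G : UGraph) : eltBasis K G = elt G := Module.Basis.mk_apply _ _ G

/-- The value at a pair of sets of edges, as a character of the tensor square. -/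
def pairValue (S T : Finset Edge) : algebra K ⊗[K] algebra K →ₐ[K] K :=
  (Algebra.TensorProduct.lmul' K).comp (Algebra.TensorProduct.map
    ((valueHom S).comp (algebra K).val) ((valueHom T).comp (algebra K).val))

lemma pairValue_tmul (S T : Finset Edge) (x y : algebra K) :
    pairValue S T (x ⊗ₜ[K] y) = (x : Series K).value S * (y : Series K).value T := by
  simp [pairValue, valueHom_apply]

/-- The coefficient at a pair of sets of edges, as a linear form on the tensor square. -/
def pairCoeff (S T : Finset Edge) : algebra K ⊗[K] algebra K →ₗ[K] K :=
  LinearMap.mul' K K ∘ₗ TensorProduct.map (coeffLinear S ∘ₗ (algebra K).val.toLinearMap)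
    (coeffLinear T ∘ₗ (algebra K).val.toLinearMap)

lemma pairCoeff_tmul (S T : Finset Edge) (x y : algebra K) :
    pairCoeff S T (x ⊗ₜ[K] y) = (x : Series K).coeff S * (y : Series K).coeff T := rfl

lemma pairValue_eq_sum (S T : Finset Edge) (t : algebra K ⊗[K] algebra K) :
    pairValue S T t = ∑ A ∈ S.powerset, ∑ B ∈ T.powerset, pairCoeff A B t := by
  induction t using TensorProduct.induction_on with
  | zero => simp
  | tmul x y =>
    simp only [pairValue_tmul, pairCoeff_tmul]
    exact sum_mul_sum _ _ _ _
  | add x y hx hy => simp only [map_add, hx, hy, sum_add_distrib]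

/-- The coefficients at pairs of realizations are the coordinates in the tensor product basis. -/
lemma eq_of_pairCoeff_eq {s t : algebra K ⊗[K] algebra K}
    (h : ∀ S T, pairCoeff S T s = pairCoeff S T t) : s = t := by
  classical
  have key : ∀ (G H : UGraph) (x : algebra K ⊗[K] algebra K),
      ((eltBasis K).tensorProduct (eltBasis K)).repr x (G, H) =
        pairCoeff (realization G) (realization H) x := by
    intro G H x
    have h1 : ∀ G, (eltBasis K).coord G =
        coeffLinear (realization G) ∘ₗ (algebra K).val.toLinearMap := by
      intro G
      refine (eltBasis K).ext fun E => ?_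
      rw [Module.Basis.coord_apply, Module.Basis.repr_self, Finsupp.single_apply, eltBasis_apply]
      refine Eq.trans ?_ (coeffLinear_elt _ _).symm
      rw [shape_realization]
      simp only [eq_comm]
    induction x using TensorProduct.induction_on with
    | zero => simp
    | tmul x y =>
      rw [Module.Basis.tensorProduct_repr_tmul_apply, pairCoeff_tmul, smul_eq_mul]
      have hx := LinearMap.congr_fun (h1 G) x
      have hy := LinearMap.congr_fun (h1 H) y
      rw [Module.Basis.coord_apply] at hx hy
      rw [hx, hy]
      simp [coeffLinear, mul_comm]
    | add x y hx hy => simp only [map_add, Finsupp.add_apply, hx, hy]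
  refine ((eltBasis K).tensorProduct (eltBasis K)).ext_elem fun ⟨G, H⟩ => ?_
  rw [key, key, h]

/-- An element of the tensor square is determined by its values. -/
lemma eq_of_pairValue_eq {s t : algebra K ⊗[K] algebra K}
    (h : ∀ S T, pairValue S T s = pairValue S T t) : s = t := by
  refine eq_of_pairCoeff_eq fun S T => ?_
  -- Möbius inversion in one variable at a time: `value_injective` recovers the dependence on `A`
  -- with `T` fixed, then that on `B`.
  have h1 : ∀ T : Finset Edge, (⟨fun A => ∑ B ∈ T.powerset, pairCoeff A B s⟩ : Series K) =
      ⟨fun A => ∑ B ∈ T.powerset, pairCoeff A B t⟩ := fun T =>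
    Series.value_injective fun S => by
      have := h S T
      rwa [pairValue_eq_sum, pairValue_eq_sum] at this
  have h2 : (⟨fun B => pairCoeff S B s⟩ : Series K) = ⟨fun B => pairCoeff S B t⟩ :=
    Series.value_injective fun T => congrArg (fun f : Series K => f.coeff S) (h1 T)
  exact congrArg (fun f : Series K => f.coeff T) h2

open Classical in
lemma value_M (G : UGraph) (T : Finset Edge) :
    (G.M K).value T = ∑ S ∈ T.powerset, if shape S = G then 1 else 0 :=
  sum_congr rfl fun S _ => coeff_M K G S

-- The value counts in `K` the subsets of shape `G`. Such a subset is a disjoint union of some `A ⊆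
-- S` and `B ⊆ T`, and the right side groups these by the shapes of `A` and `B`.
open Classical in
lemma value_M_disjUnionEdges (G : UGraph) (S T : Finset Edge) :
    (G.M K).value (disjUnionEdges S T) =
      ∑ p ∈ antidiagonal G, (p.1.M K).value S * (p.2.M K).value T := by
  simp only [value_M, sum_powerset_disjUnionEdges, shape_disjUnionEdges, sum_mul_sum]
  rw [sum_comm (s := antidiagonal G)]
  refine sum_congr rfl fun A _ => ?_
  rw [sum_comm (s := antidiagonal G)]
  refine sum_congr rfl fun B _ => ?_
  simp only [mul_ite, mul_one, mul_zero, ← ite_and]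
  -- For fixed `A` and `B` only the pair of their shapes contributes, and it is in the antidiagonal
  -- exactly when its sum is `G`.
  rw [sum_congr rfl (g := fun p : UGraph × UGraph =>
    if p = (shape A, shape B) then (1 : K) else 0), sum_ite_eq']
  · simp only [HasAntidiagonal.mem_antidiagonal]
  · rintro ⟨p, q⟩ -
    exact if_congr (by rw [Prod.mk.injEq]; grind) rfl rfl

open Classical in
lemma pairValue_comul (S T : Finset Edge) (x : algebra K) :
    pairValue S T (AntidiagonalHopf.comul (eltBasis K) x) =
      (x : Series K).value (disjUnionEdges S T) := by
  have h : (pairValue S T).toLinearMap ∘ₗ AntidiagonalHopf.comul (eltBasis K) =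
      (valueHom (disjUnionEdges S T)).toLinearMap ∘ₗ (algebra K).val.toLinearMap := by
    refine (eltBasis K).ext fun G => ?_
    rw [LinearMap.comp_apply, LinearMap.comp_apply, AntidiagonalHopf.comul_basis, map_sum]
    simp only [eltBasis_apply, AlgHom.toLinearMap_apply, pairValue_tmul, coe_elt, valueHom_apply,
      Subalgebra.coe_val, value_M_disjUnionEdges]
  have := LinearMap.congr_fun h x
  simpa [valueHom_apply] using this

-- Both sides have the same pair values, because evaluation at a disjoint union is itself a
-- character.
open Classical in
lemma comul_mul (x y : algebra K) : AntidiagonalHopf.comul (eltBasis K) (x * y) =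
    AntidiagonalHopf.comul (eltBasis K) x * AntidiagonalHopf.comul (eltBasis K) y :=
  eq_of_pairValue_eq fun S T => by
    rw [map_mul (pairValue S T), pairValue_comul, pairValue_comul, pairValue_comul, MulMemClass.coe_mul,
      Series.value_mul]

-- This exhibits the counit as a character, hence multiplicative.
open Classical in
lemma counit_eq_value (x : algebra K) :
    AntidiagonalHopf.counit (eltBasis K) x = (x : Series K).value ∅ := by
  have h : AntidiagonalHopf.counit (eltBasis K) =
      (valueHom ∅).toLinearMap ∘ₗ (algebra K).val.toLinearMap := by
    refine (eltBasis K).ext fun G => ?_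
    rw [AntidiagonalHopf.counit_basis, eltBasis_apply]
    change _ = valueHom ∅ (G.M K)
    rw [valueHom_apply, value_M, powerset_empty, sum_singleton, shape_eq_zero_iff.2 rfl]
    simp only [eq_comm]
  rw [h]
  exact valueHom_apply ∅ (x : Series K)

open Classical in
/-- The Hopf algebra structure on `UGQSym`. -/
@[reducible]
def hopfAlgebra (K : Type*) [Field K] : HopfAlgebra K (algebra K) :=
  AntidiagonalHopf.hopfAlgebra (eltBasis K) UGraph.nodesHom
    (fun _ => UGraph.eq_zero_of_nodes_eq_zero) ((eltBasis_apply 0).trans elt_zero)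
    (fun x y => by simp only [counit_eq_value, MulMemClass.coe_mul, Series.value_mul])
    comul_mul

end UGQ

end

/-! ### Filtrations -/

namespace UGQ

open Finset

variable {K H : Type*} [Field K] [Ring H] [HopfAlgebra K H] {m : UGraph → H} {d : UGraph → ℕ}

lemma degreeFiltration_mono : Monotone (degreeFiltration K m d) := fun _ _ h =>
  Submodule.span_mono (Set.image_mono fun _ hG => le_trans hG h)

lemma mem_degreeFiltration (G : UGraph) : m G ∈ degreeFiltration K m d (d G) :=
  Submodule.subset_span ⟨G, le_refl (d G), rfl⟩

lemma mul_mem_degreeFiltration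
    (hmul : ∀ G G', m G * m G' ∈ degreeFiltration K m d (d G + d G')) {i j : ℕ} {x y : H}
    (hx : x ∈ degreeFiltration K m d i) (hy : y ∈ degreeFiltration K m d j) :
    x * y ∈ degreeFiltration K m d (i + j) := by
  have h := Submodule.mul_mem_mul hx hy
  rw [degreeFiltration, degreeFiltration, Submodule.span_mul_span] at h
  refine Submodule.span_le.2 ?_ h
  rintro _ ⟨_, ⟨G, hG, rfl⟩, _, ⟨G', hG', rfl⟩, rfl⟩
  exact degreeFiltration_mono (add_le_add hG hG') (hmul G G')

/-- The antipode recursion shows that the antipode preserves the filtration. -/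
lemma antipode_mem_degreeFiltration {d : UGraph →+ ℕ} (h1 : m 0 = 1)
    (hcomul : HasSplittingCoproduct K m)
    (hmul : ∀ G G', m G * m G' ∈ degreeFiltration K m d (d G + d G')) (G : UGraph) :
    HopfAlgebra.antipode K (m G) ∈ degreeFiltration K m d (d G) := by
  classical
  -- The induction is on nodes for every `d`, which may vanish on nonempty graphs.
  induction hn : G.nodes using Nat.strong_induction_on generalizing G with
  | _ n ih =>
  subst hn
  have h := HopfAlgebra.mul_antipode_rTensor_comul_apply (R := K) (m G)
  have hmem : (G, (0 : UGraph)) ∈ antidiagonal G := by simp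
  change _ ∈ UGraph.splittings G at hmem
  rw [hcomul] at h
  simp only [map_sum, LinearMap.rTensor_tmul, LinearMap.mul'_apply] at h
  -- The term at `(G, 0)` is the antipode of `m G`; all others involve antipodes of graphs with
  -- fewer nodes.
  rw [← add_sum_erase _ _ hmem, h1, mul_one] at h
  rw [eq_sub_of_add_eq h, Algebra.algebraMap_eq_smul_one, ← h1]
  refine Submodule.sub_mem _ (Submodule.smul_mem _ _ ?_) (Submodule.sum_mem _ fun p hp => ?_)
  · refine degreeFiltration_mono ?_ (mem_degreeFiltration 0)
    simp
  · obtain ⟨hne, hp⟩ := mem_erase.1 hp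
    have hp' : p.1 + p.2 = G := HasAntidiagonal.mem_antidiagonal.1 hp
    have hlt : p.1.nodes < G.nodes := by
      have h2 : p.1.nodes + p.2.nodes = G.nodes := by
        rw [← hp']
        exact (UGraph.nodesHom.map_add _ _).symm
      have h3 : p.2.nodes ≠ 0 := fun h0 => by
        have h4 := UGraph.eq_zero_of_nodes_eq_zero h0
        rw [h4, add_zero] at hp'
        exact hne (Prod.ext hp' h4)
      omega
    rw [← hp', map_add]
    exact mul_mem_degreeFiltration hmul (ih _ hlt _ rfl) (mem_degreeFiltration _)

/-- A Hopf algebra spanned by a family with the splitting coproduct is filtered by every additive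
statistic that is submultiplicative for the product. -/
lemma isFilteredBy_of_mul_mem {d : UGraph →+ ℕ} (hm : ⊤ ≤ Submodule.span K (Set.range m))
    (h1 : m 0 = 1) (hcomul : HasSplittingCoproduct K m)
    (hmul : ∀ G G', m G * m G' ∈ degreeFiltration K m d (d G + d G')) : IsFilteredBy K m d where
  mono := degreeFiltration_mono
  exhaustive x := by
    have hx : x ∈ Submodule.span K (Set.range m) := hm trivial
    induction hx using Submodule.span_induction with
    | mem x hx =>
      obtain ⟨G, rfl⟩ := hx
      exact ⟨_, mem_degreeFiltration G⟩
    | zero => exact ⟨0, Submodule.zero_mem _⟩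
    | add x y _ _ hx hy =>
      obtain ⟨i, hi⟩ := hx
      obtain ⟨j, hj⟩ := hy
      exact ⟨max i j, Submodule.add_mem _ (degreeFiltration_mono (le_max_left _ _) hi)
        (degreeFiltration_mono (le_max_right _ _) hj)⟩
    | smul c x _ hx =>
      obtain ⟨i, hi⟩ := hx
      exact ⟨i, Submodule.smul_mem _ _ hi⟩
  one_mem := by
    rw [← h1]
    exact degreeFiltration_mono (map_zero d).le (mem_degreeFiltration 0)
  mul_mem _ _ _ _ := mul_mem_degreeFiltration hmul
  comul_mem n x hx := by
    refine Submodule.mem_comap.1 (Submodule.span_le.2 ?_ hx)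
    rintro _ ⟨G, hG, rfl⟩
    rw [SetLike.mem_coe, Submodule.mem_comap, hcomul]
    refine Submodule.sum_mem _ fun p hp => ?_
    have hp' : d p.1 + d p.2 = d G := by
      rw [← map_add, HasAntidiagonal.mem_antidiagonal.1 hp]
    have hG' : d G ≤ n := hG
    -- When `d G < n` the surplus degree goes to the second factor, so that the two indices add up
    -- to exactly `n`.
    refine Submodule.mem_iSup_of_mem (d p.1, n - d p.1) (Submodule.mem_iSup_of_mem ?_ ?_)
    · rw [HasAntidiagonal.mem_antidiagonal]
      change d p.1 + (n - d p.1) = n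
      omega
    · exact ⟨⟨m p.1, mem_degreeFiltration _⟩ ⊗ₜ ⟨m p.2,
        degreeFiltration_mono (show d p.2 ≤ n - d p.1 by omega) (mem_degreeFiltration _)⟩, rfl⟩
  antipode_mem n x hx := by
    refine Submodule.mem_comap.1 (Submodule.span_le.2 ?_ hx)
    rintro _ ⟨G, hG, rfl⟩
    exact degreeFiltration_mono hG (antipode_mem_degreeFiltration h1 hcomul hmul G)

end UGQ

open UGQ in
theorem mainTheorem3 (K : Type*) [Field K] :
    ∃ (A : Subalgebra K (Series K)) (hA : Subalgebra.toSubmodule A = UGQSym K)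
      (h : HopfAlgebra K A),
      h.toAlgebra = A.algebra ∧
      HasSplittingCoproduct K (basisElt hA) ∧
      IsFilteredBy K (basisElt hA) UGraph.edges ∧
      IsFilteredBy K (basisElt hA) UGraph.nodes := by
  let := hopfAlgebra K
  have hcomul : HasSplittingCoproduct K (elt (K := K)) := fun G => by
    have h := AntidiagonalHopf.comul_basis (eltBasis K) G
    simp only [eltBasis_apply] at h
    exact h
  have hspan : ⊤ ≤ Submodule.span K (Set.range (elt (K := K))) := by
    rw [← (eltBasis K).span_eq]
    exact Submodule.span_mono (Set.range_subset_iff.2 fun G => ⟨G, (eltBasis_apply G).symm⟩)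
  -- The Hopf structure is built on the subalgebra's own algebra structure, so their agreement is
  -- `rfl`.
  exact ⟨algebra K, toSubmodule_algebra, hopfAlgebra K, rfl, hcomul,
    isFilteredBy_of_mul_mem (d := UGraph.edgesHom) hspan elt_zero hcomul fun G G' =>
      mem_span_elt_iff.2 (M_mul_M_mem edges_shape_union_le G G'),
    isFilteredBy_of_mul_mem (d := UGraph.nodesHom) hspan elt_zero hcomul fun G G' =>
      mem_span_elt_iff.2 (M_mul_M_mem nodes_shape_union_le G G')⟩
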